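/- For a unit vector $\Psi\in\mathbb{C}^{a}\otimes\mathbb{C}^{b}$ (a bipartite pure state of systems $A$ and $B$) and $\alpha>0$, $\alpha\neq 1$, let $$E_\alpha(\Psi)=\frac{1}{1-\alpha}\log \mathrm{Tr}\,[\rho_B^\alpha],\qquad \rho_B=\mathrm{Tr}_A|\Psi\rangle\langle\Psi|,$$ be its Rényi entanglement entropy of order $\alpha$. An SLOCC protocol consists of finitely many rounds; in each round one of the two parties performs a measurement, with finitely many outcomes, on their own system (given by Kraus operators $K_k$ with $\sum_k K_k^\dagger K_k=\mathbb{1}$, which may change the dimension of that system) and communicates the result to the other party, and all later steps may depend on all earlier results; at the end a label $m$ is announced, and different sequences of results may lead to the same label. Suppose that such a protocol transforms $\Psi$ into the ensemble $\{p_m,\Psi_m\}$, i.e. label $m$ occurs with probability $p_m$ and leaves the pure state $\Psi_m$ (a unit vector in some $\mathbb{C}^{a_m}\otimes\mathbb{C}^{b_m}$). Put $\Delta E_\alpha(\Psi_m)=E_\alpha(\Psi_m)-E_\alpha(\Psi)$ and $\langle f\rangle=\sum_m p_m f(\Psi_m)$. Then for all real $\alpha, s$: - if $0<\alpha<1$ and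 $0\le s\le 1/\alpha$, then $\langle e^{s(1-\alpha)\Delta E_\alpha}\rangle\le 1$; - if $0<\alpha<1$ and $s<0$, then $\langle e^{s(1-\alpha)\Delta E_\alpha}\rangle\ge 1$; - if $\alpha>1$ and $s\ge 1/\alpha$, then $\langle e^{s(1-\alpha)\Delta E_\alpha}\rangle\ge 1$. -/

import Mathlib

open scoped Kronecker

noncomputable section

/-- Vectors of the bipartite Hilbert space `ℂ^a ⊗ ℂ^b` (Alice's factor first). -/
abbrev BipartiteVec (a b : ℕ) : Type := EuclideanSpace ℂ (Fin a × Fin b)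

/-- Operators on `ℂ^a ⊗ ℂ^b`. -/
abbrev BipartiteOp (a b : ℕ) : Type := Matrix (Fin a × Fin b) (Fin a × Fin b) ℂ

/-- The rank-one operator `|Ψ⟩⟨Ψ|`. -/
def pureDensity {a b : ℕ} (Ψ : BipartiteVec a b) : BipartiteOp a b :=
  Matrix.of fun x y => Ψ x * star (Ψ y)

/-- The partial trace over Alice's factor. -/
def partialTraceA {a b : ℕ} (ρ : BipartiteOp a b) : Matrix (Fin b) (Fin b) ℂ :=
  Matrix.of fun j j' => ∑ i : Fin a, ρ (i, j) (i, j')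

/-- The Rényi entropy `S_α(ρ) = (1 - α)⁻¹ log Tr[ρ^α]`; the power `ρ^α` of the
(positive semidefinite) matrix `ρ` is formed by the functional calculus. -/
def renyiEntropy {b : ℕ} (α : ℝ) (ρ : Matrix (Fin b) (Fin b) ℂ) : ℝ :=
  1 / (1 - α) * Real.log (Matrix.trace (cfc (fun x : ℝ => x ^ α) ρ)).re

/-- The Rényi entanglement entropy `E_α(Ψ) = S_α(Tr_A |Ψ⟩⟨Ψ|)`. -/
def renyiEntanglementEntropy {a b : ℕ} (α : ℝ) (Ψ : BipartiteVec a b) : ℝ :=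
  renyiEntropy α (partialTraceA (pureDensity Ψ))

universe u

/-- Protocols of stochastic local operations and classical communication starting on
`ℂ^a ⊗ ℂ^b`, with finitely many rounds and with outcome labels in `M`; the outcome labelled `m`
is a state of `ℂ^(outA m) ⊗ ℂ^(outB m)`. In each round one party performs a measurement on their
own system, given by Kraus operators (which may change the dimension of that system), and tells
the result to the other party; all that follows may depend on it. At the end a label is
announced. Several branches may end with the same label, so that results may be forgotten. -/
inductive SLOCCProtocol {M : Type u} (outA outB : M → ℕ) : ℕ → ℕ → Type u
  | done (m : M) : SLOCCProtocol outA outB (outA m) (outB m)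
  | alice {a b : ℕ} (n : ℕ) (a' : Fin n → ℕ)
      (K : (k : Fin n) → Matrix (Fin (a' k)) (Fin a) ℂ)
      (hK : ∑ k, (K k).conjTranspose * K k = 1)
      (next : (k : Fin n) → SLOCCProtocol outA outB (a' k) b) : SLOCCProtocol outA outB a b
  | bob {a b : ℕ} (n : ℕ) (b' : Fin n → ℕ)
      (K : (k : Fin n) → Matrix (Fin (b' k)) (Fin b) ℂ)
      (hK : ∑ k, (K k).conjTranspose * K k = 1)
      (next : (k : Fin n) → SLOCCProtocol outA outB a (b' k)) : SLOCCProtocol outA outB a b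

/-- The instrument implemented by a protocol: the unnormalised state that belongs to each
outcome label, when the protocol is run on `ρ`. -/
def SLOCCProtocol.apply {M : Type u} [DecidableEq M] {outA outB : M → ℕ} :
    {a b : ℕ} → SLOCCProtocol outA outB a b → BipartiteOp a b →
      (m : M) → BipartiteOp (outA m) (outB m)
  | _, _, .done m, ρ => Pi.single m ρ
  | _, b, .alice n _ K _ next, ρ => fun m =>
      ∑ k : Fin n, (next k).apply
        ((K k ⊗ₖ (1 : Matrix (Fin b) (Fin b) ℂ)) * ρ *
          (K k ⊗ₖ (1 : Matrix (Fin b) (Fin b) ℂ)).conjTranspose) m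
  | a, _, .bob n _ K _ next, ρ => fun m =>
      ∑ k : Fin n, (next k).apply
        (((1 : Matrix (Fin a) (Fin a) ℂ) ⊗ₖ K k) * ρ *
          ((1 : Matrix (Fin a) (Fin a) ℂ) ⊗ₖ K k).conjTranspose) m

/-- `Ψ ⟶ {p_m, Φ_m}` under some SLOCC protocol: the outcome `m` occurs with probability `p_m`
and leaves the pure state `Φ_m`. For unit vectors `Ψ` and `Φ_m` it follows that the `p_m` are
non-negative with sum one. -/
def SLOCCTransforms {M : Type u} [DecidableEq M] {outA outB : M → ℕ} {a b : ℕ}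
    (Ψ : BipartiteVec a b) (p : M → ℝ) (Φ : (m : M) → BipartiteVec (outA m) (outB m)) : Prop :=
  ∃ P : SLOCCProtocol outA outB a b,
    ∀ m, P.apply (pureDensity Ψ) m = (p m : ℂ) • pureDensity (Φ m)

end

/-!
Write `F_α(Ψ) = (Tr ρ_B^α)^{1/α}`. Since `e^{s(1-α)ΔE_α} = (F_α(Ψ_m) / F_α(Ψ))^{sα}`, Jensen's
inequality for the power `sα` (concave for `0 ≤ sα ≤ 1`, convex for `sα < 0` and for `sα ≥ 1`)
reduces the three claims to `s = 1/α`: for `α ≤ 1` the average of `F_α` does not increase, and for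
`α ≥ 1` it does not decrease.

`F_α` is homogeneous of degree one in `|Ψ⟩⟨Ψ|`, so it may be followed through the unnormalised
branches of a protocol. If Alice measures, then `ρ_B` is the sum of the unnormalised reduced states
of the outcomes, and the claim for this round is that `A ↦ (Tr A^α)^{1/α}` is superadditive on
positive semidefinite matrices for `α ≤ 1` (`Matrix.sum_schatten_le`) and subadditive for `α ≥ 1`
(`Matrix.schatten_sum_le`). Both follow from Minkowski's inequality, applied to the diagonal entries
in an eigenbasis of the sum, and Peierls' inequality (`Matrix.PosSemidef.sum_diag_le_re_trace_cfc`).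
If Bob measures, the same holds for `ρ_A`, which has the same nonzero spectrum as `ρ_B`
(`Matrix.re_trace_cfc_mul_conjTranspose_comm`).

Different branches may end with the same label `m`, but as the state announced with `m` is pure, each
of them contributes a non-negative multiple of `|Ψ_m⟩⟨Ψ_m|` (`exists_branch_weights`). Hence the
bounds add up along the protocol (`IsLocalMonotone.sum_le`). For `α = 1` the functional is the
squared norm and both bounds apply, which gives `∑ p_m = 1`.
-/

open scoped Kronecker ComplexOrder

/-! ### Minkowski's inequality for finite families -/

section Minkowski

theorem Lp_finset_sum_le {ι κ : Type*} (s : Finset ι) (t : Finset κ) {p : ℝ} (hp : 1 ≤ p)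
    (f : ι → κ → ℝ) (hf : ∀ i k, 0 ≤ f i k) :
    (∑ k ∈ t, (∑ i ∈ s, f i k) ^ p) ^ (1 / p) ≤ ∑ i ∈ s, (∑ k ∈ t, f i k ^ p) ^ (1 / p) := by
  classical
  have hp0 : p ≠ 0 := by linarith
  induction s using Finset.induction_on with
  | empty => simp [Real.zero_rpow hp0, Real.zero_rpow (inv_ne_zero hp0)]
  | insert i s hi ih =>
    simp only [Finset.sum_insert hi]
    refine (Real.Lp_add_le_of_nonneg t hp (fun k _ => hf i k)
      (fun k _ => Finset.sum_nonneg fun j _ => hf j k)).trans ?_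
    gcongr

/-- The reverse Minkowski inequality for exponents below one: it is the Minkowski inequality with
exponent `1 / p` for the `p`-th powers, with the two indices exchanged. -/
theorem sum_Lp_le_Lp_finset_sum {ι κ : Type*} (s : Finset ι) (t : Finset κ) {p : ℝ} (hp0 : 0 < p)
    (hp : p ≤ 1) (f : ι → κ → ℝ) (hf : ∀ i k, 0 ≤ f i k) :
    ∑ i ∈ s, (∑ k ∈ t, f i k ^ p) ^ (1 / p) ≤ (∑ k ∈ t, (∑ i ∈ s, f i k) ^ p) ^ (1 / p) := by
  have h := Lp_finset_sum_le t s (p := 1 / p) (by rw [le_div_iff₀ hp0]; linarith)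
    (fun k i => f i k ^ p) (fun k i => Real.rpow_nonneg (hf i k) p)
  have hpow : ∀ i k, (f i k ^ p) ^ (1 / p) = f i k := fun i k => by
    rw [← Real.rpow_mul (hf i k), mul_one_div_cancel hp0.ne', Real.rpow_one]
  simp only [hpow, one_div_one_div] at h
  have hL : 0 ≤ ∑ i ∈ s, (∑ k ∈ t, f i k ^ p) ^ (1 / p) := Finset.sum_nonneg fun i _ =>
    Real.rpow_nonneg (Finset.sum_nonneg fun k _ => Real.rpow_nonneg (hf i k) p) _
  have h' := Real.rpow_le_rpow (Real.rpow_nonneg hL p) h (one_div_pos.2 hp0).le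
  rwa [← Real.rpow_mul hL, mul_one_div_cancel hp0.ne', Real.rpow_one] at h'

end Minkowski

/-! ### Schatten functionals of positive semidefinite matrices -/

namespace Matrix

theorem PosSemidef.re_diag_conj_nonneg {n : Type*} [Fintype n] {B : Matrix n n ℂ}
    (hB : B.PosSemidef) (V : Matrix n n ℂ) (i : n) : 0 ≤ ((Vᴴ * B * V) i i).re :=
  (Complex.le_def.1 (hB.conjTranspose_mul_mul_same V).diag_nonneg).1

variable {m n : Type*} [Fintype m] [Fintype n] [DecidableEq m] [DecidableEq n]

theorem IsHermitian.re_trace_cfc {A : Matrix n n ℂ} (hA : A.IsHermitian) (f : ℝ → ℝ) :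
    (trace (cfc f A)).re = ∑ i, f (hA.eigenvalues i) := by
  rw [hA.cfc_eq, IsHermitian.cfc, Unitary.conjStarAlgAut_apply, trace_mul_cycle,
    Unitary.coe_star_mul_self, one_mul, trace_diagonal]
  simp

theorem sum_norm_sq_row {W : Matrix n n ℂ} (hW : W * Wᴴ = 1) (i : n) : ∑ j, ‖W i j‖ ^ 2 = 1 := by
  have h := congrFun (congrFun hW i) i
  rw [mul_apply, one_apply_eq] at h
  simp only [conjTranspose_apply, Complex.star_def, Complex.mul_conj,
    Complex.normSq_eq_norm_sq] at h
  exact_mod_cast h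

theorem sum_norm_sq_col {W : Matrix n n ℂ} (hW : Wᴴ * W = 1) (j : n) : ∑ i, ‖W i j‖ ^ 2 = 1 := by
  have h := sum_norm_sq_row (W := Wᴴ) (by simpa using hW) j
  simpa using h

/-- The diagonal entries of a Hermitian matrix in the orthonormal basis formed by the columns of `V`
are averages of the eigenvalues, with doubly stochastic weights. -/
theorem IsHermitian.exists_weights {A : Matrix n n ℂ} (hA : A.IsHermitian)
    (V : unitaryGroup n ℂ) : ∃ w : n → n → ℝ, (∀ i j, 0 ≤ w i j) ∧ (∀ i, ∑ j, w i j = 1) ∧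
      (∀ j, ∑ i, w i j = 1) ∧
      ∀ i, (((V : Matrix n n ℂ)ᴴ * A * (V : Matrix n n ℂ)) i i).re
        = ∑ j, w i j * hA.eigenvalues j := by
  set U : Matrix n n ℂ := (hA.eigenvectorUnitary : Matrix n n ℂ) with hU
  have hU1 : U * Uᴴ = 1 := mem_unitaryGroup_iff.1 hA.eigenvectorUnitary.2
  have hU2 : Uᴴ * U = 1 := mem_unitaryGroup_iff'.1 hA.eigenvectorUnitary.2
  have hV1 : (V : Matrix n n ℂ) * (V : Matrix n n ℂ)ᴴ = 1 := mem_unitaryGroup_iff.1 V.2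
  have hV2 : (V : Matrix n n ℂ)ᴴ * (V : Matrix n n ℂ) = 1 := mem_unitaryGroup_iff'.1 V.2
  set W : Matrix n n ℂ := (V : Matrix n n ℂ)ᴴ * U with hWdef
  have hW1 : W * Wᴴ = 1 := by
    rw [hWdef, conjTranspose_mul, conjTranspose_conjTranspose, Matrix.mul_assoc,
      ← Matrix.mul_assoc U, hU1, Matrix.one_mul, hV2]
  have hW2 : Wᴴ * W = 1 := by
    rw [hWdef, conjTranspose_mul, conjTranspose_conjTranspose, Matrix.mul_assoc,
      ← Matrix.mul_assoc _ _ U, hV1, Matrix.one_mul, hU2]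
  refine ⟨fun i j => ‖W i j‖ ^ 2, fun i j => by positivity, sum_norm_sq_row hW1,
    sum_norm_sq_col hW2, fun i => ?_⟩
  have hdiag : (V : Matrix n n ℂ)ᴴ * A * (V : Matrix n n ℂ)
      = W * diagonal (RCLike.ofReal ∘ hA.eigenvalues) * Wᴴ := by
    conv_lhs => rw [hA.spectral_theorem, Unitary.conjStarAlgAut_apply]
    rw [hWdef, conjTranspose_mul, conjTranspose_conjTranspose]
    simp only [Matrix.mul_assoc, hU]
    rfl
  rw [hdiag, mul_apply, Complex.re_sum]
  refine Finset.sum_congr rfl fun j _ => ?_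
  rw [mul_diagonal, conjTranspose_apply, mul_right_comm, Complex.star_def, Complex.mul_conj,
    Complex.normSq_eq_norm_sq]
  exact (Complex.re_ofReal_mul _ _).trans (by simp)

/-- **Peierls' inequality**: for convex `f`, the sum of `f` over the diagonal entries of `A` in any
orthonormal basis is at most `Tr f(A)`. -/
theorem PosSemidef.sum_diag_le_re_trace_cfc {A : Matrix n n ℂ} (hA : A.PosSemidef)
    (V : unitaryGroup n ℂ) {f : ℝ → ℝ} (hf : ConvexOn ℝ (Set.Ici 0) f) :
    ∑ i, f (((V : Matrix n n ℂ)ᴴ * A * (V : Matrix n n ℂ)) i i).re ≤ (trace (cfc f A)).re := by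
  obtain ⟨w, hw0, hw1, hw2, hw⟩ := hA.1.exists_weights V
  calc ∑ i, f (((V : Matrix n n ℂ)ᴴ * A * (V : Matrix n n ℂ)) i i).re
      ≤ ∑ i, ∑ j, w i j * f (hA.1.eigenvalues j) := by
        refine Finset.sum_le_sum fun i _ => ?_
        rw [hw]
        exact hf.map_sum_le (fun j _ => hw0 i j) (hw1 i) (fun j _ => hA.eigenvalues_nonneg j)
    _ = (trace (cfc f A)).re := by
        rw [Finset.sum_comm, hA.1.re_trace_cfc]
        simp only [← Finset.sum_mul, hw2, one_mul]

theorem PosSemidef.re_trace_cfc_le_sum_diag {A : Matrix n n ℂ} (hA : A.PosSemidef)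
    (V : unitaryGroup n ℂ) {f : ℝ → ℝ} (hf : ConcaveOn ℝ (Set.Ici 0) f) :
    (trace (cfc f A)).re ≤ ∑ i, f (((V : Matrix n n ℂ)ᴴ * A * (V : Matrix n n ℂ)) i i).re := by
  have h := hA.sum_diag_le_re_trace_cfc V hf.neg
  rw [hA.1.re_trace_cfc] at h ⊢
  simp only [Pi.neg_apply, Finset.sum_neg_distrib] at h
  linarith

theorem IsHermitian.re_diag_eigenvectorUnitary {A : Matrix n n ℂ} (hA : A.IsHermitian) (i : n) :
    (((hA.eigenvectorUnitary : Matrix n n ℂ)ᴴ * A * (hA.eigenvectorUnitary : Matrix n n ℂ)) i i).re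
      = hA.eigenvalues i := by
  have h := hA.conjStarAlgAut_star_eigenvectorUnitary
  rw [Unitary.conjStarAlgAut_star_apply] at h
  have h' := congrFun (congrFun h i) i
  rw [star_eq_conjTranspose] at h'
  rw [h']
  simp

/-- The Schatten functional `(Tr A^α)^{1/α}` of a positive semidefinite matrix. The power of `A` is
formed by the functional calculus, so the value is meaningful only for `A` positive semidefinite. -/
noncomputable def schatten (α : ℝ) (A : Matrix n n ℂ) : ℝ :=
  (trace (cfc (fun x : ℝ => x ^ α) A)).re ^ (1 / α)

theorem PosSemidef.re_trace_rpow_nonneg {A : Matrix n n ℂ} (hA : A.PosSemidef) (α : ℝ) :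
    0 ≤ (trace (cfc (fun x : ℝ => x ^ α) A)).re := by
  rw [hA.1.re_trace_cfc]
  exact Finset.sum_nonneg fun i _ => Real.rpow_nonneg (hA.eigenvalues_nonneg i) α

theorem PosSemidef.re_trace_rpow_pos {A : Matrix n n ℂ} (hA : A.PosSemidef) (hA0 : A ≠ 0) (α : ℝ) :
    0 < (trace (cfc (fun x : ℝ => x ^ α) A)).re := by
  rw [hA.1.re_trace_cfc]
  have : ∃ i, hA.1.eigenvalues i ≠ 0 := by
    by_contra! h
    exact hA0 (hA.1.eigenvalues_eq_zero_iff.1 (funext h))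
  obtain ⟨i, hi⟩ := this
  exact Finset.sum_pos' (fun j _ => Real.rpow_nonneg (hA.eigenvalues_nonneg j) α)
    ⟨i, Finset.mem_univ i, Real.rpow_pos_of_pos ((hA.eigenvalues_nonneg i).lt_of_ne' hi) α⟩

section Sum

variable {ι : Type*} [Fintype ι] {A : ι → Matrix n n ℂ}

/-- In an eigenbasis of the sum, the eigenvalues of the sum are the sums of the diagonal entries
of the terms. -/
theorem exists_unitary_re_trace_rpow_sum (hA : ∀ k, (A k).PosSemidef) (α : ℝ) :
    ∃ V : unitaryGroup n ℂ, (trace (cfc (fun x : ℝ => x ^ α) (∑ k, A k))).re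
      = ∑ i, (∑ k, (((V : Matrix n n ℂ)ᴴ * A k * (V : Matrix n n ℂ)) i i).re) ^ α := by
  have hS : (∑ k, A k).PosSemidef := posSemidef_sum _ fun k _ => hA k
  refine ⟨hS.1.eigenvectorUnitary, ?_⟩
  rw [hS.1.re_trace_cfc]
  refine Finset.sum_congr rfl fun i _ => ?_
  rw [← hS.1.re_diag_eigenvectorUnitary, Matrix.mul_sum, Matrix.sum_mul, sum_apply, Complex.re_sum]

/-- For `α ≥ 1` the Schatten functional is subadditive: in an eigenbasis of the sum this is
Minkowski's inequality for the diagonal entries, which are dominated by Peierls' inequality. -/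
theorem schatten_sum_le (hA : ∀ k, (A k).PosSemidef) {α : ℝ} (hα : 1 ≤ α) :
    schatten α (∑ k, A k) ≤ ∑ k, schatten α (A k) := by
  obtain ⟨V, hV⟩ := exists_unitary_re_trace_rpow_sum hA α
  rw [schatten, hV]
  refine (Lp_finset_sum_le _ _ hα (fun k i => _) fun k i => (hA k).re_diag_conj_nonneg V i).trans ?_
  refine Finset.sum_le_sum fun k _ => Real.rpow_le_rpow ?_ ?_ (by positivity)
  · exact Finset.sum_nonneg fun i _ => Real.rpow_nonneg ((hA k).re_diag_conj_nonneg V i) α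
  · exact (hA k).sum_diag_le_re_trace_cfc V (convexOn_rpow hα)

/-- For `0 < α ≤ 1` the Schatten functional is superadditive on positive semidefinite matrices:
both Minkowski's and Peierls' inequality are reversed. -/
theorem sum_schatten_le (hA : ∀ k, (A k).PosSemidef) {α : ℝ} (hα0 : 0 < α) (hα : α ≤ 1) :
    ∑ k, schatten α (A k) ≤ schatten α (∑ k, A k) := by
  obtain ⟨V, hV⟩ := exists_unitary_re_trace_rpow_sum hA α
  rw [schatten, hV]
  refine le_trans ?_ (sum_Lp_le_Lp_finset_sum _ _ hα0 hα (fun k i => _)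
    fun k i => (hA k).re_diag_conj_nonneg V i)
  refine Finset.sum_le_sum fun k _ => Real.rpow_le_rpow ((hA k).re_trace_rpow_nonneg α) ?_
    (by positivity)
  exact (hA k).re_trace_cfc_le_sum_diag V (Real.concaveOn_rpow hα0.le hα)

end Sum

theorem PosSemidef.schatten_smul {A : Matrix n n ℂ} (hA : A.PosSemidef) {α : ℝ} (hα : 0 < α)
    {c : ℝ} (hc : 0 ≤ c) : schatten α (c • A) = c * schatten α A := by
  have hsa : IsSelfAdjoint A := hA.1
  have h : cfc (fun x : ℝ => x ^ α) (c • A) = (c ^ α) • cfc (fun x : ℝ => x ^ α) A := by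
    rw [← cfc_comp_const_mul c (fun x : ℝ => x ^ α) A
        (Real.continuous_rpow_const hα.le).continuousOn hsa,
      ← cfc_const_mul (c ^ α) (fun x : ℝ => x ^ α) A
        (Real.continuous_rpow_const hα.le).continuousOn]
    refine cfc_congr fun x hx => ?_
    rw [hA.1.spectrum_real_eq_range_eigenvalues] at hx
    obtain ⟨i, rfl⟩ := hx
    exact Real.mul_rpow hc (hA.eigenvalues_nonneg i)
  rw [schatten, h, trace_smul, Complex.smul_re, smul_eq_mul,
    Real.mul_rpow (Real.rpow_nonneg hc α) (hA.re_trace_rpow_nonneg α), ← Real.rpow_mul hc,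
    mul_one_div_cancel hα.ne', Real.rpow_one, schatten]

theorem IsHermitian.schatten_one {A : Matrix n n ℂ} (hA : A.IsHermitian) :
    schatten 1 A = (trace A).re := by
  simp only [schatten, Real.rpow_one, div_one]
  rw [cfc_id' ℝ A (ha := hA.isSelfAdjoint)]

/-- `X Xᴴ` and `Xᴴ X` have the same nonzero eigenvalues, with multiplicities. -/
theorem re_trace_cfc_mul_conjTranspose_comm (X : Matrix m n ℂ) {f : ℝ → ℝ} (hf : f 0 = 0) :
    (trace (cfc f (X * Xᴴ))).re = (trace (cfc f (Xᴴ * X))).re := by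
  have hX := (posSemidef_self_mul_conjTranspose X).1
  have hX' := (posSemidef_conjTranspose_mul_self X).1
  have h := congrArg Polynomial.roots (charpoly_mul_comm' X Xᴴ)
  rw [Polynomial.roots_mul (mul_ne_zero (pow_ne_zero _ Polynomial.X_ne_zero)
      (charpoly_monic _).ne_zero), Polynomial.roots_mul (mul_ne_zero
      (pow_ne_zero _ Polynomial.X_ne_zero) (charpoly_monic _).ne_zero), Polynomial.roots_X_pow,
    Polynomial.roots_X_pow, hX.roots_charpoly_eq_eigenvalues,
    hX'.roots_charpoly_eq_eigenvalues] at h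
  have h' := congrArg (fun s : Multiset ℂ => (s.map fun z => f z.re).sum) h
  simp only [Multiset.map_add, Multiset.sum_add, Multiset.map_nsmul, Multiset.map_singleton,
    Complex.zero_re, hf, Multiset.sum_nsmul, Multiset.sum_singleton, smul_zero, zero_add,
    Multiset.map_map] at h'
  rw [hX.re_trace_cfc, hX'.re_trace_cfc]
  exact h'

theorem schatten_mul_conjTranspose_comm (X : Matrix m n ℂ) {α : ℝ} (hα : 0 < α) :
    schatten α (X * Xᴴ) = schatten α (Xᴴ * X) := by
  rw [schatten, schatten, re_trace_cfc_mul_conjTranspose_comm X (f := fun x : ℝ => x ^ α)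
    (Real.zero_rpow hα.ne')]

end Matrix

open Matrix

/-! ### Positive summands of a rank-one projection -/

section RankOne

variable {n : Type*} [Fintype n] [DecidableEq n]

/-- A positive semidefinite summand of a multiple of a rank-one projection is itself a multiple of
that projection: compressed to the orthogonal complement of `v`, both summands vanish. -/
theorem Matrix.PosSemidef.eq_smul_of_add_eq_smul {A B : Matrix n n ℂ} (hA : A.PosSemidef)
    (hB : B.PosSemidef) {v : n → ℂ} (hv : star v ⬝ᵥ v = 1) {c : ℂ}
    (h : A + B = c • vecMulVec v (star v)) :
    ∃ q : ℝ, 0 ≤ q ∧ A = (q : ℂ) • vecMulVec v (star v) := by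
  set E : Matrix n n ℂ := vecMulVec v (star v) with hE
  have hEh : Eᴴ = E := by rw [hE, conjTranspose_vecMulVec, star_star]
  have hEE : E * E = E := by
    rw [hE, vecMulVec_mul_vecMulVec, hv, one_smul]
  have hQ : (1 - E)ᴴ = 1 - E := by rw [conjTranspose_sub, hEh, conjTranspose_one]
  have hsum : (1 - E)ᴴ * A * (1 - E) + (1 - E)ᴴ * B * (1 - E) = 0 := by
    rw [← Matrix.add_mul, ← Matrix.mul_add, h, hQ]
    simp [Matrix.sub_mul, hEE]
  have hAQ : (1 - E)ᴴ * A * (1 - E) = 0 := by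
    have h1 := hA.conjTranspose_mul_mul_same (1 - E)
    have h2 := hB.conjTranspose_mul_mul_same (1 - E)
    rw [← h1.trace_eq_zero_iff]
    have h3 := congrArg trace hsum
    rw [trace_add, trace_zero] at h3
    exact ((add_eq_zero_iff_of_nonneg h1.trace_nonneg h2.trace_nonneg).1 h3).1
  have hAE : A * (1 - E) = 0 := by
    refine ext_of_mulVec_single fun j => ?_
    rw [zero_mulVec, ← mulVec_mulVec, ← hA.dotProduct_mulVec_zero_iff, star_mulVec,
      ← dotProduct_mulVec, mulVec_mulVec, mulVec_mulVec, hAQ, zero_mulVec,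
      dotProduct_zero]
  have hAE' : A = A * E := by
    rw [Matrix.mul_sub, Matrix.mul_one, sub_eq_zero] at hAE; exact hAE
  have hEA : A = E * A * E := by
    have : Aᴴ = (A * E)ᴴ := by rw [← hAE']
    rw [conjTranspose_mul, hEh, hA.1.eq] at this
    rw [← this, ← hAE']
  have hEAE : E * A * E = (star v ⬝ᵥ (A *ᵥ v)) • E := by
    rw [hE, vecMulVec_mul, vecMulVec_mul_vecMulVec, ← dotProduct_mulVec]
    ext i j; simp [vecMulVec_apply, mul_left_comm]
  have hpos := hA.dotProduct_mulVec_nonneg v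
  obtain ⟨h0, him⟩ := Complex.le_def.1 hpos
  refine ⟨(star v ⬝ᵥ (A *ᵥ v)).re, h0, ?_⟩
  rw [show (((star v ⬝ᵥ (A *ᵥ v)).re : ℝ) : ℂ) = star v ⬝ᵥ (A *ᵥ v) from
    Complex.ext rfl (by simpa using him)]
  exact hEA.trans hEAE

theorem Matrix.PosSemidef.eq_smul_of_sum_eq_smul {ι : Type*} [Fintype ι] [DecidableEq ι]
    {A : ι → Matrix n n ℂ} (hA : ∀ k, (A k).PosSemidef) {v : n → ℂ} (hv : star v ⬝ᵥ v = 1) {c : ℂ}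
    (h : ∑ k, A k = c • vecMulVec v (star v)) (k : ι) :
    ∃ q : ℝ, 0 ≤ q ∧ A k = (q : ℂ) • vecMulVec v (star v) := by
  refine (hA k).eq_smul_of_add_eq_smul (c := c) (posSemidef_sum (Finset.univ.erase k) fun j _ => hA j) hv ?_
  rw [Finset.add_sum_erase _ _ (Finset.mem_univ k)]
  exact h

end RankOne

/-! ### Coefficient matrices of bipartite vectors -/

section PureState

variable {a b a' b' : ℕ}

theorem pureDensity_eq_vecMulVec (Ψ : BipartiteVec a b) :
    pureDensity Ψ = vecMulVec Ψ (star (Ψ : Fin a × Fin b → ℂ)) := rfl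

theorem star_dotProduct_self (Ψ : BipartiteVec a b) :
    star (Ψ : Fin a × Fin b → ℂ) ⬝ᵥ Ψ = ((‖Ψ‖ ^ 2 : ℝ) : ℂ) := by
  rw [EuclideanSpace.norm_sq_eq, dotProduct]
  push_cast
  refine Finset.sum_congr rfl fun i _ => ?_
  rw [Pi.star_apply, Complex.star_def, Complex.conj_mul']

theorem posSemidef_pureDensity (Ψ : BipartiteVec a b) : (pureDensity Ψ).PosSemidef :=
  posSemidef_vecMulVec_self_star _

theorem trace_pureDensity (Ψ : BipartiteVec a b) :
    trace (pureDensity Ψ) = ((‖Ψ‖ ^ 2 : ℝ) : ℂ) := by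
  rw [pureDensity_eq_vecMulVec, trace_vecMulVec, dotProduct_comm, star_dotProduct_self]

theorem mul_pureDensity_mul_conjTranspose (L : Matrix (Fin a' × Fin b') (Fin a × Fin b) ℂ)
    (Ψ : BipartiteVec a b) :
    L * pureDensity Ψ * Lᴴ = pureDensity (WithLp.toLp 2 (L *ᵥ Ψ)) := by
  rw [pureDensity_eq_vecMulVec, pureDensity_eq_vecMulVec, mul_vecMulVec, vecMulVec_mul,
    star_mulVec]

/-- The coefficient matrix of a bipartite vector: the operator `ℂ^a → ℂ^b` (up to identifying
`ℂ^a` with its dual) that has the vector's Schmidt coefficients as singular values. -/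
def coeffMatrix (Ψ : BipartiteVec a b) : Matrix (Fin b) (Fin a) ℂ :=
  Matrix.of fun j i => Ψ (i, j)

theorem partialTraceA_pureDensity (Ψ : BipartiteVec a b) :
    partialTraceA (pureDensity Ψ) = coeffMatrix Ψ * (coeffMatrix Ψ)ᴴ := by
  ext j j'
  simp [partialTraceA, pureDensity, coeffMatrix, mul_apply]

theorem posSemidef_partialTraceA (Ψ : BipartiteVec a b) :
    (partialTraceA (pureDensity Ψ)).PosSemidef := by
  rw [partialTraceA_pureDensity]
  exact posSemidef_self_mul_conjTranspose _

theorem partialTraceA_smul (c : ℂ) (ρ : BipartiteOp a b) :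
    partialTraceA (c • ρ) = c • partialTraceA ρ := by
  ext j j'
  simp [partialTraceA, Finset.mul_sum]

theorem trace_partialTraceA (ρ : BipartiteOp a b) : trace (partialTraceA ρ) = trace ρ := by
  simp only [trace, diag_apply, partialTraceA, of_apply, Fintype.sum_prod_type]
  exact Finset.sum_comm

theorem coeffMatrix_alice (K : Matrix (Fin a') (Fin a) ℂ) (Ψ : BipartiteVec a b) :
    coeffMatrix (WithLp.toLp 2 ((K ⊗ₖ (1 : Matrix (Fin b) (Fin b) ℂ)) *ᵥ Ψ) : BipartiteVec a' b)
      = coeffMatrix Ψ * Kᵀ := by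
  ext j i
  simp [coeffMatrix, mulVec, dotProduct, mul_apply, Fintype.sum_prod_type, one_apply, mul_comm]

theorem coeffMatrix_bob (K : Matrix (Fin b') (Fin b) ℂ) (Ψ : BipartiteVec a b) :
    coeffMatrix (WithLp.toLp 2 (((1 : Matrix (Fin a) (Fin a) ℂ) ⊗ₖ K) *ᵥ Ψ) : BipartiteVec a b')
      = K * coeffMatrix Ψ := by
  ext j i
  simp [coeffMatrix, mulVec, dotProduct, mul_apply, Fintype.sum_prod_type, one_apply]

end PureState

/-! ### Local measurements and reduced states -/

section Schatten

variable {a b : ℕ} {α : ℝ}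

/-- The functional `(Tr ρ_B^α)^{1/α}` of a bipartite vector, homogeneous of degree one in
`|Ψ⟩⟨Ψ|`. -/
noncomputable def schmidtFunctional (α : ℝ) {a b : ℕ} (Ψ : BipartiteVec a b) : ℝ :=
  schatten α (partialTraceA (pureDensity Ψ))

theorem schmidtFunctional_eq_mul (hα : 0 < α) {a b : ℕ} (Ψ Φ : BipartiteVec a b) {c : ℝ}
    (hc : 0 ≤ c) (h : pureDensity Ψ = (c : ℂ) • pureDensity Φ) :
    schmidtFunctional α Ψ = c * schmidtFunctional α Φ := by
  rw [schmidtFunctional, h, partialTraceA_smul, Complex.coe_smul,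
    (posSemidef_partialTraceA Φ).schatten_smul hα hc, schmidtFunctional]

theorem schmidtFunctional_one (Ψ : BipartiteVec a b) : schmidtFunctional 1 Ψ = ‖Ψ‖ ^ 2 := by
  rw [schmidtFunctional, (posSemidef_partialTraceA Ψ).1.schatten_one, trace_partialTraceA,
    trace_pureDensity, Complex.ofReal_re]

/-- Alice's measurement only decomposes Bob's reduced state. -/
theorem sum_partialTraceA_alice {n : ℕ} {a' : Fin n → ℕ}
    (K : (k : Fin n) → Matrix (Fin (a' k)) (Fin a) ℂ) (hK : ∑ k, (K k)ᴴ * K k = 1)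
    (Ψ : BipartiteVec a b) :
    ∑ k, partialTraceA (pureDensity (WithLp.toLp 2
      ((K k ⊗ₖ (1 : Matrix (Fin b) (Fin b) ℂ)) *ᵥ Ψ) : BipartiteVec (a' k) b))
      = partialTraceA (pureDensity Ψ) := by
  have hKT : ∑ k, (K k)ᵀ * ((K k)ᵀ)ᴴ = 1 := by
    have h := congrArg Matrix.transpose hK
    rw [transpose_sum, transpose_one] at h
    rw [← h]
    refine Finset.sum_congr rfl fun k _ => ?_
    rw [transpose_mul]; rfl
  have hterm : ∀ k, partialTraceA (pureDensity (WithLp.toLp 2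
      ((K k ⊗ₖ (1 : Matrix (Fin b) (Fin b) ℂ)) *ᵥ Ψ) : BipartiteVec (a' k) b))
      = coeffMatrix Ψ * ((K k)ᵀ * ((K k)ᵀ)ᴴ) * (coeffMatrix Ψ)ᴴ := fun k => by
    rw [partialTraceA_pureDensity, coeffMatrix_alice, conjTranspose_mul]
    simp only [Matrix.mul_assoc]
  simp only [hterm]
  rw [← Matrix.sum_mul, ← Matrix.mul_sum, hKT, Matrix.mul_one, partialTraceA_pureDensity]

theorem schmidtFunctional_eq_conjTranspose_mul (hα : 0 < α) (Ψ : BipartiteVec a b) :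
    schmidtFunctional α Ψ = schatten α ((coeffMatrix Ψ)ᴴ * coeffMatrix Ψ) := by
  rw [schmidtFunctional, partialTraceA_pureDensity, schatten_mul_conjTranspose_comm _ hα]

/-- Bob's measurement only decomposes Alice's reduced state, which is the transpose of `Xᴴ X` for
the coefficient matrix `X`. -/
theorem sum_conjTranspose_mul_bob {n : ℕ} {b' : Fin n → ℕ}
    (K : (k : Fin n) → Matrix (Fin (b' k)) (Fin b) ℂ) (hK : ∑ k, (K k)ᴴ * K k = 1)
    (Ψ : BipartiteVec a b) :
    ∑ k, (K k * coeffMatrix Ψ)ᴴ * (K k * coeffMatrix Ψ) = (coeffMatrix Ψ)ᴴ * coeffMatrix Ψ := by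
  have hterm : ∀ k, (K k * coeffMatrix Ψ)ᴴ * (K k * coeffMatrix Ψ)
      = (coeffMatrix Ψ)ᴴ * ((K k)ᴴ * K k) * coeffMatrix Ψ := fun k => by
    rw [conjTranspose_mul]; simp only [Matrix.mul_assoc]
  simp only [hterm]
  rw [← Matrix.sum_mul, ← Matrix.mul_sum, hK, Matrix.mul_one]

end Schatten

/-! ### Induction over the protocol -/

section Protocol

universe u

variable {M : Type u} [DecidableEq M] {outA outB : M → ℕ}

theorem SLOCCProtocol.posSemidef_apply {a b : ℕ} (P : SLOCCProtocol outA outB a b) :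
    ∀ {ρ : BipartiteOp a b}, ρ.PosSemidef → ∀ m, (P.apply ρ m).PosSemidef := by
  induction P with
  | done m₀ =>
    intro ρ hρ m
    rw [SLOCCProtocol.apply]
    by_cases h : m = m₀
    · subst h; simpa using hρ
    · rw [Pi.single_eq_of_ne h]; exact PosSemidef.zero
  | alice n a' K hK next ih =>
    intro ρ hρ m
    rw [SLOCCProtocol.apply]
    exact posSemidef_sum _ fun k _ => ih k (hρ.mul_mul_conjTranspose_same _) m
  | bob n b' K hK next ih =>
    intro ρ hρ m
    rw [SLOCCProtocol.apply]
    exact posSemidef_sum _ fun k _ => ih k (hρ.mul_mul_conjTranspose_same _) m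

/-- A functional of bipartite vectors that is homogeneous of degree one in `|Ψ⟩⟨Ψ|` and does not
increase, in total over the unnormalised outcomes, under one measurement by either party. -/
structure IsLocalMonotone (G : ∀ {a b : ℕ}, BipartiteVec a b → ℝ) : Prop where
  eq_mul : ∀ {a b : ℕ} (Ψ Φ : BipartiteVec a b) {c : ℝ}, 0 ≤ c →
    pureDensity Ψ = (c : ℂ) • pureDensity Φ → G Ψ = c * G Φ
  sum_alice_le : ∀ {a b n : ℕ} {a' : Fin n → ℕ} (K : (k : Fin n) → Matrix (Fin (a' k)) (Fin a) ℂ),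
    ∑ k, (K k)ᴴ * K k = 1 → ∀ Ψ : BipartiteVec a b,
    ∑ k, G (WithLp.toLp 2 ((K k ⊗ₖ (1 : Matrix (Fin b) (Fin b) ℂ)) *ᵥ Ψ) : BipartiteVec (a' k) b)
      ≤ G Ψ
  sum_bob_le : ∀ {a b n : ℕ} {b' : Fin n → ℕ} (K : (k : Fin n) → Matrix (Fin (b' k)) (Fin b) ℂ),
    ∑ k, (K k)ᴴ * K k = 1 → ∀ Ψ : BipartiteVec a b,
    ∑ k, G (WithLp.toLp 2 (((1 : Matrix (Fin a) (Fin a) ℂ) ⊗ₖ K k) *ᵥ Ψ) : BipartiteVec a (b' k))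
      ≤ G Ψ

theorem nonneg_of_smul_pureDensity_posSemidef {a b : ℕ} {Φ : BipartiteVec a b} (hΦ : ‖Φ‖ = 1)
    {q : ℝ} (h : ((q : ℂ) • pureDensity Φ).PosSemidef) : 0 ≤ q := by
  have := (Complex.le_def.1 h.trace_nonneg).1
  simpa [trace_smul, trace_pureDensity, hΦ] using this

theorem smul_pureDensity_injective {a b : ℕ} {Φ : BipartiteVec a b} (hΦ : ‖Φ‖ = 1)
    {q r : ℝ} (h : (q : ℂ) • pureDensity Φ = (r : ℂ) • pureDensity Φ) : q = r := by
  have := congrArg trace h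
  simpa [trace_smul, trace_pureDensity, hΦ] using this

/-- The branches of a measurement that end with the same pure state contribute real
multiples of it, whose weights add up. -/
theorem exists_branch_weights {M : Type*} {outA outB : M → ℕ}
    {Φ : (m : M) → BipartiteVec (outA m) (outB m)} (hΦ : ∀ m, ‖Φ m‖ = 1) {n : ℕ}
    {σ : Fin n → (m : M) → BipartiteOp (outA m) (outB m)}
    (hσ : ∀ k m, (σ k m).PosSemidef) {q : M → ℝ}
    (h : ∀ m, ∑ k, σ k m = (q m : ℂ) • pureDensity (Φ m)) :
    ∃ r : Fin n → M → ℝ, (∀ k m, σ k m = (r k m : ℂ) • pureDensity (Φ m)) ∧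
      ∀ m, q m = ∑ k, r k m := by
  have hex : ∀ k m, ∃ r : ℝ, 0 ≤ r ∧ σ k m = (r : ℂ) • pureDensity (Φ m) := fun k m =>
    PosSemidef.eq_smul_of_sum_eq_smul (fun k => hσ k m)
      (by rw [star_dotProduct_self, hΦ]; norm_num) (h m) k
  choose r _ hr using hex
  refine ⟨r, hr, fun m => smul_pureDensity_injective (hΦ m) ?_⟩
  rw [← h m]
  push_cast
  rw [Finset.sum_smul]
  exact Finset.sum_congr rfl fun k _ => hr k m

/-- A local monotone does not increase on average under a protocol. The vector is not assumed to be
normalised, and `q m` is the total weight of the branches labelled `m`, so that the bound for a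
measurement is the sum of the bounds for the protocols that follow its outcomes. -/
theorem IsLocalMonotone.sum_le [Fintype M] {G : ∀ {a b : ℕ}, BipartiteVec a b → ℝ}
    (hG : IsLocalMonotone @G) {Φ : (m : M) → BipartiteVec (outA m) (outB m)}
    (hΦ : ∀ m, ‖Φ m‖ = 1) {a b : ℕ} (P : SLOCCProtocol outA outB a b) :
    ∀ (Ψ : BipartiteVec a b) (q : M → ℝ),
      (∀ m, P.apply (pureDensity Ψ) m = (q m : ℂ) • pureDensity (Φ m)) →
      ∑ m, q m * G (Φ m) ≤ G Ψ := by
  induction P with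
  | done m₀ =>
    intro Ψ q h
    simp only [SLOCCProtocol.apply] at h
    have h0 := h m₀
    rw [Pi.single_eq_same] at h0
    rw [Finset.sum_eq_single m₀]
    · refine (hG.eq_mul Ψ (Φ m₀) ?_ h0).ge
      exact nonneg_of_smul_pureDensity_posSemidef (hΦ m₀) (h0 ▸ posSemidef_pureDensity Ψ)
    · intro m _ hm
      have hm' := h m
      rw [Pi.single_eq_of_ne hm] at hm'
      have : q m = 0 := smul_pureDensity_injective (hΦ m) (by rw [← hm']; simp)
      rw [this, zero_mul]
    · simp
  | @alice a b n a' K hK next ih =>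
    intro Ψ q h
    simp only [SLOCCProtocol.apply, mul_pureDensity_mul_conjTranspose] at h
    obtain ⟨r, hr, hq⟩ := exists_branch_weights hΦ
      (fun k m => (next k).posSemidef_apply (posSemidef_pureDensity _) m) h
    simp only [hq, Finset.sum_mul]
    rw [Finset.sum_comm]
    exact (Finset.sum_le_sum fun k _ => ih k _ (r k) (hr k)).trans (hG.sum_alice_le K hK Ψ)
  | @bob a b n b' K hK next ih =>
    intro Ψ q h
    simp only [SLOCCProtocol.apply, mul_pureDensity_mul_conjTranspose] at h
    obtain ⟨r, hr, hq⟩ := exists_branch_weights hΦ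
      (fun k m => (next k).posSemidef_apply (posSemidef_pureDensity _) m) h
    simp only [hq, Finset.sum_mul]
    rw [Finset.sum_comm]
    exact (Finset.sum_le_sum fun k _ => ih k _ (r k) (hr k)).trans (hG.sum_bob_le K hK Ψ)

theorem isLocalMonotone_schmidtFunctional {α : ℝ} (hα0 : 0 < α) (hα : α ≤ 1) :
    IsLocalMonotone (@schmidtFunctional α) where
  eq_mul Ψ Φ _ hc h := schmidtFunctional_eq_mul hα0 Ψ Φ hc h
  sum_alice_le K hK Ψ := by
    rw [schmidtFunctional.eq_1 α Ψ, ← sum_partialTraceA_alice K hK Ψ]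
    exact sum_schatten_le (fun k => posSemidef_partialTraceA _) hα0 hα
  sum_bob_le K hK Ψ := by
    simp only [schmidtFunctional_eq_conjTranspose_mul hα0, coeffMatrix_bob]
    rw [← sum_conjTranspose_mul_bob K hK Ψ]
    exact sum_schatten_le (fun k => posSemidef_conjTranspose_mul_self _) hα0 hα

theorem isLocalMonotone_neg_schmidtFunctional {α : ℝ} (hα : 1 ≤ α) :
    IsLocalMonotone (fun {_ _} Ψ => -schmidtFunctional α Ψ) where
  eq_mul Ψ Φ c hc h := by
    rw [schmidtFunctional_eq_mul (by linarith) Ψ Φ hc h, mul_neg]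
  sum_alice_le K hK Ψ := by
    rw [Finset.sum_neg_distrib, neg_le_neg_iff, schmidtFunctional.eq_1 α Ψ,
      ← sum_partialTraceA_alice K hK Ψ]
    exact schatten_sum_le (fun k => posSemidef_partialTraceA _) hα
  sum_bob_le K hK Ψ := by
    have hα0 : 0 < α := by linarith
    simp only [schmidtFunctional_eq_conjTranspose_mul hα0, coeffMatrix_bob]
    rw [Finset.sum_neg_distrib, neg_le_neg_iff, ← sum_conjTranspose_mul_bob K hK Ψ]
    exact schatten_sum_le (fun k => posSemidef_conjTranspose_mul_self _) hα

end Protocol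

/-! ### Ensembles and Rényi entropies -/

section Ensemble

/-- Jensen's inequality for a non-positive power, by way of `x ^ t = exp (t * log x)` and the
concavity of the logarithm. -/
theorem one_le_sum_mul_rpow {ι : Type*} [Fintype ι] {w x : ι → ℝ} (hw : ∀ i, 0 ≤ w i)
    (hw1 : ∑ i, w i = 1) (hx : ∀ i, 0 < x i) (hle : ∑ i, w i * x i ≤ 1) {t : ℝ} (ht : t ≤ 0) :
    1 ≤ ∑ i, w i * x i ^ t := by
  have hlog := strictConcaveOn_log_Ioi.concaveOn.le_map_sum (t := Finset.univ)
    (fun i _ => hw i) hw1 (fun i _ => hx i)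
  have hexp := convexOn_exp.map_sum_le (t := Finset.univ) (p := fun i => t * Real.log (x i))
    (fun i _ => hw i) hw1 (fun i _ => Set.mem_univ _)
  simp only [smul_eq_mul] at hlog hexp
  have h0 : ∑ i, w i * Real.log (x i) ≤ 0 :=
    hlog.trans (Real.log_nonpos (Finset.sum_nonneg fun i _ => mul_nonneg (hw i) (hx i).le) hle)
  have h1 : 0 ≤ ∑ i, w i * (t * Real.log (x i)) := by
    simp only [mul_left_comm _ t, ← Finset.mul_sum]
    exact mul_nonneg_of_nonpos_of_nonpos ht h0
  refine (Real.one_le_exp h1).trans (hexp.trans_eq (Finset.sum_congr rfl fun i _ => ?_))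
  rw [Real.rpow_def_of_pos (hx i), mul_comm t]

variable {M : Type*} [DecidableEq M] {outA outB : M → ℕ} {a b : ℕ}
  {Ψ : BipartiteVec a b} {p : M → ℝ} {Φ : (m : M) → BipartiteVec (outA m) (outB m)} {α : ℝ}

theorem SLOCCTransforms.nonneg (hΦ : ∀ m, ‖Φ m‖ = 1) (h : SLOCCTransforms Ψ p Φ) (m : M) :
    0 ≤ p m := by
  obtain ⟨P, hP⟩ := h
  exact nonneg_of_smul_pureDensity_posSemidef (hΦ m)
    (hP m ▸ P.posSemidef_apply (posSemidef_pureDensity Ψ) m)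

theorem SLOCCTransforms.sum_mul_schmidtFunctional_le [Fintype M] (hΦ : ∀ m, ‖Φ m‖ = 1)
    (h : SLOCCTransforms Ψ p Φ) (hα0 : 0 < α) (hα : α ≤ 1) :
    ∑ m, p m * schmidtFunctional α (Φ m) ≤ schmidtFunctional α Ψ := by
  obtain ⟨P, hP⟩ := h
  exact (isLocalMonotone_schmidtFunctional hα0 hα).sum_le hΦ P Ψ p hP

theorem SLOCCTransforms.schmidtFunctional_le_sum_mul [Fintype M] (hΦ : ∀ m, ‖Φ m‖ = 1)
    (h : SLOCCTransforms Ψ p Φ) (hα : 1 ≤ α) :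
    schmidtFunctional α Ψ ≤ ∑ m, p m * schmidtFunctional α (Φ m) := by
  obtain ⟨P, hP⟩ := h
  have := (isLocalMonotone_neg_schmidtFunctional hα).sum_le hΦ P Ψ p hP
  simp only [mul_neg, Finset.sum_neg_distrib] at this
  linarith

/-- The functional at `α = 1` is the squared norm, which is both sub- and superadditive. -/
theorem SLOCCTransforms.sum_eq_one [Fintype M] (hΨ : ‖Ψ‖ = 1) (hΦ : ∀ m, ‖Φ m‖ = 1)
    (h : SLOCCTransforms Ψ p Φ) : ∑ m, p m = 1 := by
  have h1 := h.sum_mul_schmidtFunctional_le hΦ one_pos le_rfl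
  have h2 := h.schmidtFunctional_le_sum_mul hΦ le_rfl
  simp only [schmidtFunctional_one, hΨ, hΦ, one_pow, mul_one] at h1 h2
  exact le_antisymm h1 h2

theorem partialTraceA_pureDensity_ne_zero (hΨ : ‖Ψ‖ = 1) :
    partialTraceA (pureDensity Ψ) ≠ 0 := by
  intro h
  have := congrArg trace h
  rw [trace_partialTraceA, trace_pureDensity, hΨ] at this
  simp at this

theorem schmidtFunctional_pos (hΨ : ‖Ψ‖ = 1) : 0 < schmidtFunctional α Ψ :=
  Real.rpow_pos_of_pos ((posSemidef_partialTraceA Ψ).re_trace_rpow_pos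
    (partialTraceA_pureDensity_ne_zero hΨ) α) _

/-- Both sides are `log Tr ρ_B^α`. -/
theorem one_sub_mul_renyiEntanglementEntropy (hΨ : ‖Ψ‖ = 1) (hα0 : 0 < α) (hα : α ≠ 1) :
    (1 - α) * renyiEntanglementEntropy α Ψ = α * Real.log (schmidtFunctional α Ψ) := by
  have hα' : 1 - α ≠ 0 := sub_ne_zero.2 hα.symm
  rw [renyiEntanglementEntropy, renyiEntropy, schmidtFunctional, schatten,
    Real.log_rpow ((posSemidef_partialTraceA Ψ).re_trace_rpow_pos
      (partialTraceA_pureDensity_ne_zero hΨ) α)]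
  field_simp

theorem exp_renyi_diff {c d : ℕ} {Φ : BipartiteVec c d} (hΨ : ‖Ψ‖ = 1) (hΦ : ‖Φ‖ = 1) (hα0 : 0 < α)
    (hα : α ≠ 1) (s : ℝ) :
    Real.exp (s * (1 - α) * (renyiEntanglementEntropy α Φ - renyiEntanglementEntropy α Ψ))
      = (schmidtFunctional α Φ / schmidtFunctional α Ψ) ^ (s * α) := by
  have h1 := one_sub_mul_renyiEntanglementEntropy hΨ hα0 hα
  have h2 := one_sub_mul_renyiEntanglementEntropy hΦ hα0 hα
  have hF := schmidtFunctional_pos (α := α) hΨ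
  have hG := schmidtFunctional_pos (α := α) hΦ
  rw [Real.rpow_def_of_pos (div_pos hG hF), Real.log_div hG.ne' hF.ne']
  congr 1
  linear_combination s * h2 - s * h1

end Ensemble

theorem theorem1 {a b : ℕ} (Ψ : BipartiteVec a b) (hΨ : ‖Ψ‖ = 1)
    {M : Type*} [Fintype M] [DecidableEq M] {outA outB : M → ℕ}
    (p : M → ℝ) (Φ : (m : M) → BipartiteVec (outA m) (outB m)) (hΦ : ∀ m, ‖Φ m‖ = 1)
    (hSLOCC : SLOCCTransforms Ψ p Φ) (α s : ℝ) :
    (0 < α → α < 1 → 0 ≤ s → s ≤ 1 / α →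
      ∑ m, p m * Real.exp (s * (1 - α) *
        (renyiEntanglementEntropy α (Φ m) - renyiEntanglementEntropy α Ψ)) ≤ 1) ∧
    (0 < α → α < 1 → s < 0 →
      1 ≤ ∑ m, p m * Real.exp (s * (1 - α) *
        (renyiEntanglementEntropy α (Φ m) - renyiEntanglementEntropy α Ψ))) ∧
    (1 < α → 1 / α ≤ s →
      1 ≤ ∑ m, p m * Real.exp (s * (1 - α) *
        (renyiEntanglementEntropy α (Φ m) - renyiEntanglementEntropy α Ψ))) := by
  have hp0 := hSLOCC.nonneg hΦ
  have hp1 := hSLOCC.sum_eq_one hΨ hΦ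
  have hF : 0 < schmidtFunctional α Ψ := schmidtFunctional_pos hΨ
  have hx : ∀ m, 0 < schmidtFunctional α (Φ m) / schmidtFunctional α Ψ := fun m =>
    div_pos (schmidtFunctional_pos (hΦ m)) hF
  have hmean : ∑ m, p m * (schmidtFunctional α (Φ m) / schmidtFunctional α Ψ)
      = (∑ m, p m * schmidtFunctional α (Φ m)) / schmidtFunctional α Ψ := by
    simp only [← mul_div_assoc, Finset.sum_div]
  have hmean_pos : 0 < ∑ m, p m * (schmidtFunctional α (Φ m) / schmidtFunctional α Ψ) := by
    obtain ⟨m, hm⟩ : ∃ m, p m ≠ 0 := by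
      by_contra! h
      simp [h] at hp1
    exact Finset.sum_pos' (fun m _ => mul_nonneg (hp0 m) (hx m).le)
      ⟨m, Finset.mem_univ m, mul_pos ((hp0 m).lt_of_ne' hm) (hx m)⟩
  refine ⟨fun hα0 hα1 hs0 hs1 => ?_, fun hα0 hα1 hs => ?_, fun hα hs => ?_⟩
  · simp only [exp_renyi_diff hΨ (hΦ _) hα0 hα1.ne]
    have hle : ∑ m, p m * (schmidtFunctional α (Φ m) / schmidtFunctional α Ψ) ≤ 1 := by
      rw [hmean, div_le_one hF]
      exact hSLOCC.sum_mul_schmidtFunctional_le hΦ hα0 hα1.le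
    have hconc := Real.concaveOn_rpow (p := s * α) (by positivity) ((le_div_iff₀ hα0).1 hs1)
    have hJ := hconc.le_map_sum (t := Finset.univ) (fun m _ => hp0 m) hp1 (fun m _ => (hx m).le)
    simp only [smul_eq_mul] at hJ
    exact hJ.trans (Real.rpow_le_one hmean_pos.le hle (by positivity))
  · simp only [exp_renyi_diff hΨ (hΦ _) hα0 hα1.ne]
    have hle : ∑ m, p m * (schmidtFunctional α (Φ m) / schmidtFunctional α Ψ) ≤ 1 := by
      rw [hmean, div_le_one hF]
      exact hSLOCC.sum_mul_schmidtFunctional_le hΦ hα0 hα1.le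
    have hneg : s * α ≤ 0 := mul_nonpos_of_nonpos_of_nonneg hs.le hα0.le
    exact one_le_sum_mul_rpow hp0 hp1 hx hle hneg
  · have hα0 : 0 < α := by linarith
    simp only [exp_renyi_diff hΨ (hΦ _) hα0 hα.ne']
    have hle : 1 ≤ ∑ m, p m * (schmidtFunctional α (Φ m) / schmidtFunctional α Ψ) := by
      rw [hmean, one_le_div hF]
      exact hSLOCC.schmidtFunctional_le_sum_mul hΦ hα.le
    have hsα : 1 ≤ s * α := (div_le_iff₀ hα0).1 hs
    have hJ := (convexOn_rpow hsα).map_sum_le (t := Finset.univ) (fun m _ => hp0 m) hp1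
      (fun m _ => (hx m).le)
    simp only [smul_eq_mul] at hJ
    exact (Real.one_le_rpow hle (by linarith)).trans hJ
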